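/- Conventions. A frame is a complete lattice in which finite meets distribute over arbitrary joins; frame maps preserve finite meets and all joins, and the category of locales is the opposite of the category of frames. Write $\Omega X$ for the frame of opens of a locale $X$ and $f^{-1}:\Omega Y\to\Omega X$ for the frame map of a locale map $f:X\to Y$. Let $L\otimes L$ be the coproduct frame, generated under joins by the rectangles $x\otimes y=\iota_1(x)\wedge\iota_2(y)$, so that $\Omega(X\times X)=\Omega X\otimes\Omega X$. A localic relation on $X$ is a sublocale $r:R\rightarrowtail X\times X$, with source and target maps $s=\mathrm{pr}_1 r$ and $t=\mathrm{pr}_2 r$. It has open cones if $s$ and $t$ are open, i.e. $s^{-1}$ and $t^{-1}$ have left adjoints $s_!$, $t_!$ with $s_!(O\wedge s^{-1}U)=s_!(O)\wedge U$ and $t_!(O\wedge t^{-1}U)=t_!(O)\wedge U$. Its cones are then $\uparrow_R=t_!s^{-1}$ and $\downarrow_R=s_!t^{-1}$. A locale map $f:X\to Y$ is monotone $(X,R)\to(Y,Q)$ if $(f\times f)\circ r$ factors through $Q\rightarrowtail Y\times Y$. Let $\mathsf{rocLoc}$ be the category of pairs $(X,R)$ of a locale and an open cone relation on it, with monotone maps.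 A conic frame $(L,\uparrow,\downarrow)$ is a frame $L$ with maps $\uparrow,\downarrow:L\to L$ that preserve all joins and are parallel: $\uparrow x\wedge y\le\,\uparrow(x\wedge\downarrow y)$ and $x\wedge\downarrow y\le\,\downarrow(\uparrow x\wedge y)$ for all $x,y\in L$. A conic morphism $h:(L,\uparrow,\downarrow)\to(M,\uparrow',\downarrow')$ is a frame map $h:L\to M$ with $\uparrow' h(x)\le h(\uparrow x)$ and $\downarrow' h(x)\le h(\downarrow x)$ for all $x\in L$. Let $\mathsf{ConicFrm}$ be the resulting category. For a conic frame $(\Omega X,\uparrow,\downarrow)$ let $\sim$ be the relation on rectangles of $\Omega X\otimes\Omega X$ given by $a\otimes b\sim c\otimes d$ iff $\uparrow a\wedge b=\,\uparrow c\wedge d$ and $a\wedge\downarrow b=c\wedge\downarrow d$. Let $R_{\uparrow\downarrow}\rightarrowtail X\times X$ be the sublocale whose sublocale set consists of the $\sim$-saturated elements, i.e. those $w\in\Omega X\otimes\Omega X$ such that whenever $p\sim q$ and $v\in\Omega X\otimes\Omega X$, one has $p\wedge v\le w$ iff $q\wedge v\le w$. Theorem. The functors $$\mathsf{Cone}:\mathsf{rocLoc}\to\mathsf{ConicFrm}^{\mathrm{op}},\quad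 (X,R)\mapsto(\Omega X,\uparrow_R,\downarrow_R),\quad f\mapsto f^{-1},$$ $$\mathsf{Rel}:\mathsf{ConicFrm}^{\mathrm{op}}\to\mathsf{rocLoc},\quad (\Omega X,\uparrow,\downarrow)\mapsto(X,R_{\uparrow\downarrow}),\quad f^{-1}\mapsto f,$$ are well defined and form an adjunction $\mathsf{Cone}\dashv\mathsf{Rel}$ such that $\mathsf{Cone}\circ\mathsf{Rel}=\mathrm{id}$ and the counit is the identity. For every $(X,R)$ in $\mathsf{rocLoc}$ one has an inclusion of sublocales $R\subseteq R_{\uparrow_R\downarrow_R}$, and the unit at $(X,R)$ is this inclusion, i.e. the monotone map $(X,R)\to(X,R_{\uparrow_R\downarrow_R})$ carried by $\mathrm{id}_X$. -/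

import Mathlib

open CategoryTheory Opposite

universe u

namespace LocalicCones

/-! ### Binary coproducts of frames -/

section Coproduct

variable {L M N : Type u} [Order.Frame L] [Order.Frame M] [Order.Frame N]

/-- A lower set of `L × M` is a coproduct ideal if it is closed under all joins (including the empty
join) in each of the two variables separately. -/
def IsCoprodIdeal (I : LowerSet (L × M)) : Prop :=
  (∀ (S : Set L) (y : M), (∀ x ∈ S, (x, y) ∈ I) → (sSup S, y) ∈ I) ∧
    (∀ (x : L) (S : Set M), (∀ y ∈ S, (x, y) ∈ I) → (x, sSup S) ∈ I)

theorem mem_himp_iff {P : Type u} [PartialOrder P] (A I : LowerSet P) (p : P) :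
    p ∈ A ⇨ I ↔ ∀ q ≤ p, q ∈ A → q ∈ I := by
  rw [← LowerSet.Iic_le, le_himp_iff]
  constructor
  · intro h q hq hA
    exact h ⟨hq, hA⟩
  · rintro h q ⟨hq, hA⟩
    exact h q hq hA

variable (L M) in
/-- The coproduct ideals form a sublocale of the frame of lower sets of `L × M`. -/
def coprodIdeals : Sublocale (LowerSet (L × M)) where
  carrier := {I | IsCoprodIdeal I}
  sInf_mem' := by
    intro s hs
    constructor
    · intro S y h
      rw [LowerSet.mem_sInf_iff]
      intro I hI
      exact (hs hI).1 S y fun x hx => LowerSet.mem_sInf_iff.1 (h x hx) I hI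
    · intro x S h
      rw [LowerSet.mem_sInf_iff]
      intro I hI
      exact (hs hI).2 x S fun y hy => LowerSet.mem_sInf_iff.1 (h y hy) I hI
  himp_mem' := by
    intro A I hI
    constructor
    · intro S y h
      rw [mem_himp_iff]
      rintro ⟨a, b⟩ ⟨ha, hb⟩ hA
      have e : a = sSup ((fun x => a ⊓ x) '' S) := by
        rw [sSup_image, ← inf_sSup_eq]
        exact (inf_eq_left.2 ha).symm
      rw [e]
      refine hI.1 _ _ ?_
      rintro _ ⟨x, hx, rfl⟩
      exact (mem_himp_iff A I (x, y)).1 (h x hx) (a ⊓ x, b) ⟨inf_le_right, hb⟩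
        (A.lower (show (a ⊓ x, b) ≤ (a, b) from ⟨inf_le_left, le_rfl⟩) hA)
    · intro x S h
      rw [mem_himp_iff]
      rintro ⟨a, b⟩ ⟨ha, hb⟩ hA
      have e : b = sSup ((fun y => b ⊓ y) '' S) := by
        rw [sSup_image, ← inf_sSup_eq]
        exact (inf_eq_left.2 hb).symm
      rw [e]
      refine hI.2 _ _ ?_
      rintro _ ⟨y, hy, rfl⟩
      exact (mem_himp_iff A I (x, y)).1 (h y hy) (a, b ⊓ y) ⟨ha, inf_le_right⟩
        (A.lower (show (a, b ⊓ y) ≤ (a, b) from ⟨le_rfl, inf_le_left⟩) hA)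

variable (L M) in
/-- The coproduct `L ⊗ M` of two frames, realised as the frame of coproduct ideals. -/
abbrev Coprod : Type u := ↥(coprodIdeals L M)

/-- The basic rectangle `x ⊗ y`: the least coproduct ideal that contains `(x, y)`. -/
def rect (x : L) (y : M) : Coprod L M := (coprodIdeals L M).restrict (LowerSet.Iic (x, y))

theorem rect_le_iff {x : L} {y : M} {I : Coprod L M} : rect x y ≤ I ↔ (x, y) ∈ I.1 := by
  rw [rect, (coprodIdeals L M).giRestrict.gc.le_iff_le, LowerSet.Iic_le]

theorem rect_mono {x x' : L} {y y' : M} (hx : x ≤ x') (hy : y ≤ y') : rect x y ≤ rect x' y' :=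
  rect_le_iff.2 ((rect x' y').1.lower (show (x, y) ≤ (x', y') from ⟨hx, hy⟩)
    (rect_le_iff.1 le_rfl))

theorem rect_inf_rect (x x' : L) (y y' : M) :
    rect x y ⊓ rect x' y' = rect (x ⊓ x') (y ⊓ y') := by
  simp only [rect]
  rw [← map_inf]
  congr 1
  ext p
  simp [Prod.le_def]

theorem coprod_le_iff {I J : Coprod L M} : I ≤ J ↔ ∀ x y, rect x y ≤ I → rect x y ≤ J := by
  constructor
  · intro h x y hx
    exact hx.trans h
  · rintro h ⟨x, y⟩ hp
    exact rect_le_iff.1 (h x y (rect_le_iff.2 hp))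

variable (L M) in
/-- The first coproduct injection `x ↦ x ⊗ ⊤`. -/
def inl : FrameHom L (Coprod L M) where
  toFun x := rect x ⊤
  map_inf' x x' := by rw [rect_inf_rect, inf_idem]
  map_top' := by
    refine top_le_iff.1 (coprod_le_iff.2 fun x y _ => rect_mono le_top le_top)
  map_sSup' S := by
    refine le_antisymm ?_ (sSup_le ?_)
    · rw [rect_le_iff]
      refine (sSup ((fun x => rect x ⊤) '' S) : Coprod L M).2.1 S ⊤ fun x hx => ?_
      exact rect_le_iff.1 (le_sSup ⟨x, hx, rfl⟩)
    · rintro _ ⟨x, hx, rfl⟩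
      exact rect_mono (le_sSup hx) le_rfl

variable (L M) in
/-- The second coproduct injection `y ↦ ⊤ ⊗ y`. -/
def inr : FrameHom M (Coprod L M) where
  toFun y := rect ⊤ y
  map_inf' y y' := by rw [rect_inf_rect, inf_idem]
  map_top' := by
    refine top_le_iff.1 (coprod_le_iff.2 fun x y _ => rect_mono le_top le_top)
  map_sSup' S := by
    refine le_antisymm ?_ (sSup_le ?_)
    · rw [rect_le_iff]
      refine (sSup ((fun y => rect ⊤ y) '' S) : Coprod L M).2.2 ⊤ S fun y hy => ?_
      exact rect_le_iff.1 (le_sSup ⟨y, hy, rfl⟩)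
    · rintro _ ⟨y, hy, rfl⟩
      exact rect_mono le_rfl (le_sSup hy)

theorem inl_inf_inr (x : L) (y : M) : inl L M x ⊓ inr L M y = rect x y := by
  change rect x ⊤ ⊓ rect ⊤ y = _
  rw [rect_inf_rect, inf_top_eq, top_inf_eq]

/-- The coproduct ideal of all `(x, y)` with `h x ⊓ k y ≤ n`. -/
def copairAdj (h : FrameHom L N) (k : FrameHom M N) (n : N) : Coprod L M :=
  ⟨⟨{p | h p.1 ⊓ k p.2 ≤ n}, fun _ _ hqp hp =>
      (inf_le_inf (OrderHomClass.mono h hqp.1) (OrderHomClass.mono k hqp.2)).trans hp⟩, by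
    constructor
    · intro S y hS
      change h (sSup S) ⊓ k y ≤ n
      rw [map_sSup, sSup_inf_eq]
      simp only [iSup_le_iff]
      rintro _ ⟨x, hx, rfl⟩
      exact hS x hx
    · intro x S hS
      change h x ⊓ k (sSup S) ≤ n
      rw [map_sSup, inf_sSup_eq]
      simp only [iSup_le_iff]
      rintro _ ⟨y, hy, rfl⟩
      exact hS y hy⟩

theorem copair_gc (h : FrameHom L N) (k : FrameHom M N) :
    GaloisConnection (fun I : Coprod L M => ⨆ p ∈ I.1, h p.1 ⊓ k p.2) (copairAdj h k) := by
  intro I n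
  simp only [iSup_le_iff]
  rfl

/-- The copairing `[h, k] : L ⊗ M → N`. -/
def copair (h : FrameHom L N) (k : FrameHom M N) : FrameHom (Coprod L M) N where
  toFun I := ⨆ p ∈ I.1, h p.1 ⊓ k p.2
  map_inf' I J := by
    refine le_antisymm (le_inf ((copair_gc h k).monotone_l inf_le_left)
      ((copair_gc h k).monotone_l inf_le_right)) ?_
    simp only [iSup_inf_eq, inf_iSup_eq, iSup_le_iff]
    intro q hq p hp
    refine le_trans (le_of_eq ?_) (le_iSup₂_of_le (p ⊓ q)
      ⟨I.1.lower inf_le_left ‹_›, J.1.lower inf_le_right ‹_›⟩ le_rfl)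
    simp only [Prod.fst_inf, Prod.snd_inf, map_inf]
    ac_rfl
  map_top' := by
    refine top_le_iff.1 (le_iSup₂_of_le (⊤, ⊤) trivial ?_)
    simp
  map_sSup' S := by
    rw [sSup_image]
    exact (copair_gc h k).l_sSup

theorem copair_rect (h : FrameHom L N) (k : FrameHom M N) (x : L) (y : M) :
    copair h k (rect x y) = h x ⊓ k y := by
  refine le_antisymm (((copair_gc h k) _ _).2 (rect_le_iff.2 ?_)) ?_
  · exact (le_rfl : h x ⊓ k y ≤ h x ⊓ k y)
  · exact le_iSup₂_of_le (f := fun p (_ : p ∈ (rect x y).1) => h p.1 ⊓ k p.2) (x, y)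
      (rect_le_iff.1 le_rfl) le_rfl

/-- Frame maps out of `L ⊗ M` are determined by their values on rectangles. -/
theorem coprod_hom_ext {f g : FrameHom (Coprod L M) N}
    (h : ∀ x y, f (rect x y) = g (rect x y)) : f = g := by
  ext I
  have e : I = sSup {J | ∃ x y, rect x y ≤ I ∧ J = rect x y} := by
    refine le_antisymm (coprod_le_iff.2 fun x y hxy => le_sSup ⟨x, y, hxy, rfl⟩) (sSup_le ?_)
    rintro _ ⟨x, y, hxy, rfl⟩
    exact hxy
  rw [e, map_sSup, map_sSup]
  congr 1
  refine Set.image_congr ?_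
  rintro _ ⟨x, y, -, rfl⟩
  exact h x y

/-- The frame map `h ⊗ h : L ⊗ L → M ⊗ M`. If `h` is the inverse image map of a map of locales `f`,
this is the inverse image map of `f × f`. -/
def coprodMap (h : FrameHom L M) : FrameHom (Coprod L L) (Coprod M M) :=
  copair ((inl M M).comp h) ((inr M M).comp h)

theorem coprodMap_rect (h : FrameHom L M) (x y : L) :
    coprodMap h (rect x y) = rect (h x) (h y) := by
  rw [coprodMap, copair_rect]
  exact inl_inf_inr _ _

end Coproduct

/-! ### The sublocale presented by a binary relation -/

section Saturated

variable {F N : Type u} [Order.Frame F] [Order.Frame N]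

/-- The sublocale of all `r`-saturated elements. -/
def saturated (r : F → F → Prop) : Sublocale F where
  carrier := {s | ∀ a b c, r a b → (a ⊓ c ≤ s ↔ b ⊓ c ≤ s)}
  sInf_mem' := by
    intro S hS a b c hab
    simp only [le_sInf_iff]
    exact forall₂_congr fun s hs => hS hs a b c hab
  himp_mem' := by
    intro d s hs a b c hab
    rw [le_himp_iff, le_himp_iff, inf_assoc, inf_assoc]
    exact hs a b (c ⊓ d) hab

theorem restrict_le_iff (S : Sublocale F) {a : F} {s : S} : S.restrict a ≤ s ↔ a ≤ s.1 :=
  S.giRestrict.gc a s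

theorem restrict_coe (S : Sublocale F) (s : S) : S.restrict s.1 = s :=
  S.giRestrict.l_u_eq s

theorem le_restrict (S : Sublocale F) (a : F) : a ≤ (S.restrict a).1 :=
  (restrict_le_iff S).1 le_rfl

theorem saturated_restrict_eq {r : F → F → Prop} {a b : F} (h : r a b) :
    (saturated r).restrict a = (saturated r).restrict b := by
  have key : ∀ s : saturated r, a ≤ s.1 ↔ b ≤ s.1 := fun s => by
    simpa using s.2 a b ⊤ h
  refine le_antisymm ?_ ?_
  · rw [restrict_le_iff, key]
    exact le_restrict _ b
  · rw [restrict_le_iff, ← key]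
    exact le_restrict _ a

/-- A frame map that equalises `r` factors through the quotient map of `r`. -/
theorem exists_saturated_lift (r : F → F → Prop) (g : FrameHom F N)
    (hg : ∀ a b, r a b → g a = g b) :
    ∃ k : FrameHom (saturated r) N, k.comp (saturated r).restrict = g := by
  have gr : ∀ a, g ((saturated r).restrict a).1 = g a := by
    intro a
    refine le_antisymm ?_ (OrderHomClass.mono g (le_restrict _ a))
    have gc : ∀ x n, g x ≤ n ↔ x ≤ sSup {y | g y ≤ n} := by
      intro x n
      refine ⟨fun h => le_sSup h, fun h => (OrderHomClass.mono g h).trans ?_⟩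
      rw [map_sSup]
      refine sSup_le ?_
      rintro _ ⟨y, hy, rfl⟩
      exact hy
    let s : saturated r := ⟨sSup {y | g y ≤ g a}, by
      intro x y c hxy
      rw [← gc, ← gc, map_inf, map_inf, hg x y hxy]⟩
    have h1 : a ≤ s.1 := (gc a (g a)).1 le_rfl
    exact (gc _ _).2 ((restrict_le_iff (saturated r)).2 h1)
  refine ⟨{ toFun := fun s => g s.1, map_inf' := ?_, map_top' := ?_, map_sSup' := ?_ }, ?_⟩
  · intro a b
    exact map_inf g a.1 b.1
  · exact map_top g
  · intro S
    have e : sSup S = (saturated r).restrict (sSup (Subtype.val '' S)) := by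
      rw [map_sSup, Set.image_image]
      simp only [restrict_coe, Set.image_id']
    rw [e, gr, map_sSup, Set.image_image]
  · ext a
    exact gr a

end Saturated

/-! ### Open maps and open cone relations -/

section OpenCones

variable {L M : Type u} [Order.Frame L] [Order.Frame M]

/-- The frame map `h : M → L` is the inverse image map of an open map of locales: it has a left
adjoint which satisfies Frobenius reciprocity. -/
def IsOpenFrameMap (h : FrameHom M L) : Prop :=
  ∃ l : L → M, GaloisConnection l h ∧ ∀ (x : L) (y : M), l (x ⊓ h y) = l x ⊓ y

/-- The direct image `x ↦ ⋀ {y | x ≤ h y}` along `h`. It is the left adjoint of `h`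
whenever there is one. -/
def directImage (h : FrameHom M L) (x : L) : M := sInf {y | x ≤ h y}

theorem directImage_eq {h : FrameHom M L} {l : L → M} (gc : GaloisConnection l h) :
    directImage h = l := by
  funext x
  refine le_antisymm (sInf_le (gc.le_u_l x)) (le_sInf fun y hy => gc.l_le hy)

theorem IsOpenFrameMap.gc {h : FrameHom M L} (H : IsOpenFrameMap h) :
    GaloisConnection (directImage h) h := by
  obtain ⟨l, gc, -⟩ := H
  rwa [directImage_eq gc]

theorem IsOpenFrameMap.frobenius {h : FrameHom M L} (H : IsOpenFrameMap h) (x : L) (y : M) :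
    directImage h (x ⊓ h y) = directImage h x ⊓ y := by
  obtain ⟨l, gc, fr⟩ := H
  rw [directImage_eq gc]
  exact fr x y

/-- The inverse image map of the source map of a localic relation `R`. -/
def source (R : Sublocale (Coprod L L)) : FrameHom L R := R.restrict.comp (inl L L)

/-- The inverse image map of the target map of a localic relation `R`. -/
def target (R : Sublocale (Coprod L L)) : FrameHom L R := R.restrict.comp (inr L L)

/-- A localic relation has open cones if its source and target maps are open. -/
def HasOpenCones (R : Sublocale (Coprod L L)) : Prop :=
  IsOpenFrameMap (source R) ∧ IsOpenFrameMap (target R)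

/-- The induced up cone, the direct image along the target of the inverse image along the source. -/
def HasOpenCones.up {R : Sublocale (Coprod L L)} (H : HasOpenCones R) : sSupHom L L where
  toFun x := directImage (target R) (source R x)
  map_sSup' S := by
    rw [map_sSup, H.2.gc.l_sSup, iSup_image, sSup_image]

/-- The induced down cone, the direct image along the source of the inverse image along the
target. -/
def HasOpenCones.down {R : Sublocale (Coprod L L)} (H : HasOpenCones R) : sSupHom L L where
  toFun x := directImage (source R) (target R x)
  map_sSup' S := by
    rw [map_sSup, H.1.gc.l_sSup, iSup_image, sSup_image]

/-- A pair of cones is parallel. -/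
def Parallel (up down : L → L) : Prop :=
  ∀ x y, up x ⊓ y ≤ up (x ⊓ down y) ∧ x ⊓ down y ≤ down (up x ⊓ y)

theorem HasOpenCones.parallel {R : Sublocale (Coprod L L)} (H : HasOpenCones R) :
    Parallel H.up H.down := by
  intro x y
  constructor
  · change directImage (target R) (source R x) ⊓ y ≤ directImage (target R) (source R (x ⊓ _))
    rw [← H.2.frobenius, map_inf]
    exact H.2.gc.monotone_l (inf_le_inf_left _ (H.1.gc.le_u_l _))
  · change x ⊓ directImage (source R) (target R y) ≤ directImage (source R) (target R (_ ⊓ y))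
    rw [inf_comm, ← H.1.frobenius, map_inf, inf_comm]
    exact H.1.gc.monotone_l (inf_le_inf_right _ (H.2.gc.le_u_l _))

end OpenCones

/-! ### The relation induced by a pair of cones -/

section InducedRelation

variable {L : Type u} [Order.Frame L]

/-- The relation on rectangles: `x ⊗ y ∼ x' ⊗ y'` iff `up x ⊓ y = up x' ⊓ y'` and
`x ⊓ down y = x' ⊓ down y'`. -/
def Sim (up down : L → L) (a b : Coprod L L) : Prop :=
  ∃ x y x' y', a = rect x y ∧ b = rect x' y' ∧
    up x ⊓ y = up x' ⊓ y' ∧ x ⊓ down y = x' ⊓ down y'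

/-- The localic relation induced by a pair of cones. -/
def inducedRel (up down : L → L) : Sublocale (Coprod L L) := saturated (Sim up down)

theorem mono_of_sSupHom (c : sSupHom L L) : Monotone c := OrderHomClass.mono c

theorem inducedRel_restrict_reduced {up down : sSupHom L L} (par : Parallel up down) (x y : L) :
    (inducedRel up down).restrict (rect x y) =
      (inducedRel up down).restrict (rect (x ⊓ down y) (up x ⊓ y)) := by
  refine saturated_restrict_eq ⟨x, y, _, _, rfl, rfl, ?_, ?_⟩
  · refine le_antisymm (le_inf (par x y).1 le_rfl) ?_
    exact inf_le_right
  · refine le_antisymm (le_inf le_rfl (par x y).2) ?_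
    exact inf_le_left

/-- The two halves of the fact that `∼` is stable under meets with rectangles. -/
theorem reduced_inf_le {up down : sSupHom L L} (par : Parallel up down) {a b c d : L}
    (h1 : up a ⊓ b = up c ⊓ d) (h2 : a ⊓ down b = c ⊓ down d) (x y : L) :
    up (a ⊓ x) ⊓ (b ⊓ y) ≤ up (c ⊓ x) ⊓ (d ⊓ y) ∧
      a ⊓ x ⊓ down (b ⊓ y) ≤ c ⊓ x ⊓ down (d ⊓ y) := by
  have mu := mono_of_sSupHom up
  have md := mono_of_sSupHom down
  have hD : a ⊓ x ⊓ down (b ⊓ y) ≤ c ⊓ x := by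
    refine le_inf ?_ (inf_le_left.trans inf_le_right)
    calc a ⊓ x ⊓ down (b ⊓ y) ≤ a ⊓ down b := inf_le_inf inf_le_left (md inf_le_left)
      _ ≤ c := h2.le.trans inf_le_left
  have hU : up (a ⊓ x) ⊓ (b ⊓ y) ≤ d ⊓ y := by
    refine le_inf ?_ (inf_le_right.trans inf_le_right)
    calc up (a ⊓ x) ⊓ (b ⊓ y) ≤ up a ⊓ b := inf_le_inf (mu inf_le_left) inf_le_left
      _ ≤ d := h1.le.trans inf_le_right
  exact ⟨le_inf ((par _ _).1.trans (mu hD)) hU, le_inf hD ((par _ _).2.trans (md hU))⟩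

/-- The element of `inducedRel up down` of all `(x, y)` with `x ⊓ down y ≤ z`. -/
def downOpen {up down : sSupHom L L} (par : Parallel up down) (z : L) : inducedRel up down :=
  ⟨⟨⟨{p | p.1 ⊓ down p.2 ≤ z}, fun _ _ hqp hp =>
      (inf_le_inf hqp.1 (mono_of_sSupHom down hqp.2)).trans hp⟩, by
    constructor
    · intro S y hS
      change sSup S ⊓ down y ≤ z
      rw [sSup_inf_eq]
      exact iSup₂_le hS
    · intro x S hS
      change x ⊓ down (sSup S) ≤ z
      rw [map_sSup, inf_sSup_eq]
      simp only [iSup_le_iff]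
      rintro _ ⟨y, hy, rfl⟩
      exact hS y hy⟩, by
    have key : ∀ (a b c d : L) (e : Coprod L L), up a ⊓ b = up c ⊓ d →
        a ⊓ down b = c ⊓ down d → ∀ I : Coprod L L,
        (∀ x y, rect x y ≤ I ↔ x ⊓ down y ≤ z) →
        rect c d ⊓ e ≤ I → rect a b ⊓ e ≤ I := by
      intro a b c d e h1 h2 I hI h
      refine coprod_le_iff.2 fun x y hxy => ?_
      have hs : rect (c ⊓ x) (d ⊓ y) ≤ I := by
        rw [← rect_inf_rect]
        exact (inf_le_inf_left _ (hxy.trans inf_le_right)).trans h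
      have ht : rect (a ⊓ x) (b ⊓ y) ≤ I := by
        rw [hI] at hs ⊢
        exact (reduced_inf_le par h1 h2 x y).2.trans hs
      rw [← rect_inf_rect] at ht
      exact (le_inf (hxy.trans inf_le_left) le_rfl).trans ht
    rintro _ _ e ⟨x, y, x', y', rfl, rfl, h1, h2⟩
    exact ⟨key x' y' x y e h1.symm h2.symm _ (fun _ _ => rect_le_iff),
      key x y x' y' e h1 h2 _ (fun _ _ => rect_le_iff)⟩⟩

/-- The element of `inducedRel up down` of all `(x, y)` with `up x ⊓ y ≤ z`. -/
def upOpen {up down : sSupHom L L} (par : Parallel up down) (z : L) : inducedRel up down :=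
  ⟨⟨⟨{p | up p.1 ⊓ p.2 ≤ z}, fun _ _ hqp hp =>
      (inf_le_inf (mono_of_sSupHom up hqp.1) hqp.2).trans hp⟩, by
    constructor
    · intro S y hS
      change up (sSup S) ⊓ y ≤ z
      rw [map_sSup, sSup_inf_eq]
      simp only [iSup_le_iff]
      rintro _ ⟨x, hx, rfl⟩
      exact hS x hx
    · intro x S hS
      change up x ⊓ sSup S ≤ z
      rw [inf_sSup_eq]
      exact iSup₂_le hS⟩, by
    have key : ∀ (a b c d : L) (e : Coprod L L), up a ⊓ b = up c ⊓ d →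
        a ⊓ down b = c ⊓ down d → ∀ I : Coprod L L,
        (∀ x y, rect x y ≤ I ↔ up x ⊓ y ≤ z) →
        rect c d ⊓ e ≤ I → rect a b ⊓ e ≤ I := by
      intro a b c d e h1 h2 I hI h
      refine coprod_le_iff.2 fun x y hxy => ?_
      have hs : rect (c ⊓ x) (d ⊓ y) ≤ I := by
        rw [← rect_inf_rect]
        exact (inf_le_inf_left _ (hxy.trans inf_le_right)).trans h
      have ht : rect (a ⊓ x) (b ⊓ y) ≤ I := by
        rw [hI] at hs ⊢
        exact (reduced_inf_le par h1 h2 x y).1.trans hs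
      rw [← rect_inf_rect] at ht
      exact (le_inf (hxy.trans inf_le_left) le_rfl).trans ht
    rintro _ _ e ⟨x, y, x', y', rfl, rfl, h1, h2⟩
    exact ⟨key x' y' x y e h1.symm h2.symm _ (fun _ _ => rect_le_iff),
      key x y x' y' e h1 h2 _ (fun _ _ => rect_le_iff)⟩⟩

theorem source_inducedRel {up down : sSupHom L L} (par : Parallel up down) (z : L) :
    source (inducedRel up down) z = downOpen par z := by
  refine le_antisymm ?_ ?_
  · refine (restrict_le_iff _).2 ?_
    exact rect_le_iff.2 (show z ⊓ down ⊤ ≤ z from inf_le_left)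
  · refine coprod_le_iff.2 fun x y hxy => ?_
    have hz : x ⊓ down y ≤ z := rect_le_iff.1 hxy
    refine (restrict_le_iff _).1 ?_
    rw [inducedRel_restrict_reduced par]
    exact OrderHomClass.mono _ (rect_mono hz le_top)

theorem target_inducedRel {up down : sSupHom L L} (par : Parallel up down) (z : L) :
    target (inducedRel up down) z = upOpen par z := by
  refine le_antisymm ?_ ?_
  · refine (restrict_le_iff _).2 ?_
    exact rect_le_iff.2 (show up ⊤ ⊓ z ≤ z from inf_le_right)
  · refine coprod_le_iff.2 fun x y hxy => ?_
    have hz : up x ⊓ y ≤ z := rect_le_iff.1 hxy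
    refine (restrict_le_iff _).1 ?_
    rw [inducedRel_restrict_reduced par]
    exact OrderHomClass.mono _ (rect_mono le_top hz)

/-- The relation induced by a join-preserving parallel pair of cones has open cones. -/
theorem hasOpenCones_inducedRel {up down : sSupHom L L} (par : Parallel up down) :
    HasOpenCones (inducedRel up down) := by
  constructor
  · have gc : GaloisConnection (fun O : inducedRel up down => ⨆ p ∈ O.1.1, p.1 ⊓ down p.2)
        (source (inducedRel up down)) := by
      intro O z
      rw [source_inducedRel par]
      simp only [iSup_le_iff]
      rfl
    refine ⟨_, gc, fun O z => le_antisymm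
      (le_inf (gc.monotone_l inf_le_left) (gc.l_le inf_le_right)) ?_⟩
    simp only [iSup_inf_eq, iSup_le_iff]
    intro p hp
    refine le_trans (le_of_eq ?_) (le_iSup₂_of_le
      (f := fun q (_ : q ∈ (O ⊓ source (inducedRel up down) z).1.1) => q.1 ⊓ down q.2)
      (p.1 ⊓ z, p.2) ⟨O.1.1.lower
        (show (p.1 ⊓ z, p.2) ≤ p from ⟨inf_le_left, le_rfl⟩) hp, ?_⟩ le_rfl)
    · exact inf_right_comm _ _ _
    · rw [source_inducedRel par]
      exact (inf_le_left.trans inf_le_right : p.1 ⊓ z ⊓ down p.2 ≤ z)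
  · have gc : GaloisConnection (fun O : inducedRel up down => ⨆ p ∈ O.1.1, up p.1 ⊓ p.2)
        (target (inducedRel up down)) := by
      intro O z
      rw [target_inducedRel par]
      simp only [iSup_le_iff]
      rfl
    refine ⟨_, gc, fun O z => le_antisymm
      (le_inf (gc.monotone_l inf_le_left) (gc.l_le inf_le_right)) ?_⟩
    simp only [iSup_inf_eq, iSup_le_iff]
    intro p hp
    refine le_trans (le_of_eq ?_) (le_iSup₂_of_le
      (f := fun q (_ : q ∈ (O ⊓ target (inducedRel up down) z).1.1) => up q.1 ⊓ q.2)
      (p.1, p.2 ⊓ z) ⟨O.1.1.lower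
        (show (p.1, p.2 ⊓ z) ≤ p from ⟨le_rfl, inf_le_left⟩) hp, ?_⟩ le_rfl)
    · exact inf_assoc _ _ _
    · rw [target_inducedRel par]
      exact (inf_le_right.trans inf_le_right : up p.1 ⊓ (p.2 ⊓ z) ≤ z)

end InducedRelation

/-! ### The category of locales with localic relations -/

/-- The inverse image map of a map of locales. -/
def invImage {X Y : Locale.{u}} (f : X ⟶ Y) : FrameHom Y X := (Quiver.Hom.unop f).hom

/-- The map of locales with a given inverse image map. -/
def ofInvImage {X Y : Locale.{u}} (h : FrameHom Y X) : X ⟶ Y := Quiver.Hom.op (Frm.ofHom h)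

/-- A locale equipped with a localic relation, that is, a sublocale of `X × X`. -/
structure RLoc : Type (u + 1) where
  /-- The underlying locale. -/
  X : Locale.{u}
  /-- The localic relation. -/
  rel : Sublocale (Coprod X X)

/-- The map of locales `f` is monotone: `f × f` restricts to a map `R ⟶ Q`, where `R` and `Q` are the
relations of `A` and `B`. -/
def IsMonotone {A B : RLoc.{u}} (f : A.X ⟶ B.X) : Prop :=
  ∃ g : FrameHom B.rel A.rel,
    g.comp B.rel.restrict = A.rel.restrict.comp (coprodMap (invImage f))

namespace RLoc

/-- Monotone maps. -/
@[ext]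
structure Hom (A B : RLoc.{u}) : Type u where
  /-- The underlying map of locales. -/
  base : A.X ⟶ B.X
  monotone : IsMonotone base

instance : Category RLoc.{u} where
  Hom := Hom
  id A := ⟨𝟙 A.X, FrameHom.id _, by
    have e : coprodMap (invImage (𝟙 A.X)) = FrameHom.id _ :=
      coprod_hom_ext fun x y => coprodMap_rect _ x y
    rw [e]
    rfl⟩
  comp {A B C} f g := ⟨f.base ≫ g.base, by
    obtain ⟨k, hk⟩ := f.monotone
    obtain ⟨l, hl⟩ := g.monotone
    refine ⟨k.comp l, ?_⟩
    have e : coprodMap (invImage (f.base ≫ g.base)) =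
        (coprodMap (invImage f.base)).comp (coprodMap (invImage g.base)) :=
      coprod_hom_ext fun x y => by
        rw [coprodMap_rect, FrameHom.comp_apply, coprodMap_rect, coprodMap_rect]
        rfl
    rw [e, FrameHom.comp_assoc, hl, ← FrameHom.comp_assoc, hk, FrameHom.comp_assoc]⟩
  id_comp f := Hom.ext (Category.id_comp f.base)
  comp_id f := Hom.ext (Category.comp_id f.base)
  assoc f g h := Hom.ext (Category.assoc f.base g.base h.base)

end RLoc

/-- The full subcategory of `RLoc` on the locales equipped with an open cone relation. -/
abbrev RocLoc : Type (u + 1) :=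
  ObjectProperty.FullSubcategory fun A : RLoc.{u} => HasOpenCones A.rel

/-! ### The category of conic frames -/

/-- A conic frame: a frame with a join-preserving parallel pair of cones. -/
structure ConicFrm : Type (u + 1) where
  /-- The underlying frame. -/
  L : Frm.{u}
  /-- The up cone. -/
  up : sSupHom L L
  /-- The down cone. -/
  down : sSupHom L L
  parallel : Parallel up down

namespace ConicFrm

/-- Conic morphisms. -/
@[ext]
structure Hom (C D : ConicFrm.{u}) : Type u where
  /-- The underlying frame map. -/
  base : C.L ⟶ D.L
  up_le : ∀ x, D.up (base.hom x) ≤ base.hom (C.up x)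
  down_le : ∀ x, D.down (base.hom x) ≤ base.hom (C.down x)

instance : Category ConicFrm.{u} where
  Hom := Hom
  id C := ⟨𝟙 C.L, fun _ => le_rfl, fun _ => le_rfl⟩
  comp f g := ⟨f.base ≫ g.base,
    fun x => (g.up_le _).trans (OrderHomClass.mono g.base.hom (f.up_le x)),
    fun x => (g.down_le _).trans (OrderHomClass.mono g.base.hom (f.down_le x))⟩
  id_comp f := Hom.ext (Category.id_comp f.base)
  comp_id f := Hom.ext (Category.comp_id f.base)
  assoc f g h := Hom.ext (Category.assoc f.base g.base h.base)

end ConicFrm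

/-! ### The two functors -/

theorem source_monotone {A B : RLoc.{u}} {f : A.X ⟶ B.X} {g : FrameHom B.rel A.rel}
    (hg : g.comp B.rel.restrict = A.rel.restrict.comp (coprodMap (invImage f))) (x : B.X) :
    source A.rel (invImage f x) = g (source B.rel x) := by
  have h := DFunLike.congr_fun hg (rect x ⊤)
  simp only [FrameHom.comp_apply, coprodMap_rect, map_top] at h
  exact h.symm

theorem target_monotone {A B : RLoc.{u}} {f : A.X ⟶ B.X} {g : FrameHom B.rel A.rel}
    (hg : g.comp B.rel.restrict = A.rel.restrict.comp (coprodMap (invImage f))) (x : B.X) :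
    target A.rel (invImage f x) = g (target B.rel x) := by
  have h := DFunLike.congr_fun hg (rect ⊤ x)
  simp only [FrameHom.comp_apply, coprodMap_rect, map_top] at h
  exact h.symm

/-- The functor `(X, R) ↦ (Ω X, up, down)`, `f ↦ f⁻¹`. -/
def Cone : RocLoc.{u} ⥤ ConicFrm.{u}ᵒᵖ where
  obj A := op ⟨Frm.of A.obj.X, A.property.up, A.property.down, A.property.parallel⟩
  map {A B} f := Quiver.Hom.op
    { base := Frm.ofHom (invImage f.hom.base)
      up_le := by
        intro x
        obtain ⟨g, hg⟩ := f.hom.monotone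
        refine A.property.2.gc.l_le ?_
        change source A.obj.rel (invImage f.hom.base x) ≤
          target A.obj.rel (invImage f.hom.base (B.property.up x))
        rw [source_monotone hg, target_monotone hg]
        exact OrderHomClass.mono g (B.property.2.gc.le_u_l _)
      down_le := by
        intro x
        obtain ⟨g, hg⟩ := f.hom.monotone
        refine A.property.1.gc.l_le ?_
        change target A.obj.rel (invImage f.hom.base x) ≤
          source A.obj.rel (invImage f.hom.base (B.property.down x))
        rw [source_monotone hg, target_monotone hg]
        exact OrderHomClass.mono g (B.property.1.gc.le_u_l _) }
  map_id _ := rfl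
  map_comp _ _ := rfl

/-- A conic frame, regarded as a locale with a localic relation. -/
def ConicFrm.toRLoc (C : ConicFrm.{u}) : RLoc.{u} where
  X := Locale.of C.L
  rel := inducedRel C.up C.down

theorem ConicFrm.Hom.equalises_sim {C D : ConicFrm.{u}} (f : ConicFrm.Hom C D)
    {s t : Coprod C.L C.L} (hst : Sim C.up C.down s t) :
    (inducedRel D.up D.down).restrict (coprodMap f.base.hom s) =
      (inducedRel D.up D.down).restrict (coprodMap f.base.hom t) := by
  have key : ∀ a b c d : C.L, C.up a ⊓ b = C.up c ⊓ d → a ⊓ C.down b = c ⊓ C.down d →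
      (inducedRel D.up D.down).restrict (rect (f.base.hom a) (f.base.hom b)) ≤
        (inducedRel D.up D.down).restrict (rect (f.base.hom c) (f.base.hom d)) := by
    intro a b c d h1 h2
    rw [inducedRel_restrict_reduced D.parallel]
    refine OrderHomClass.mono _ (rect_mono ?_ ?_)
    · refine (inf_le_inf_left _ (f.down_le b)).trans ?_
      rw [← map_inf, h2, map_inf]
      exact inf_le_left
    · refine (inf_le_inf_right _ (f.up_le a)).trans ?_
      rw [← map_inf, h1, map_inf]
      exact inf_le_right
  obtain ⟨a, b, c, d, rfl, rfl, h1, h2⟩ := hst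
  rw [coprodMap_rect, coprodMap_rect]
  exact le_antisymm (key a b c d h1 h2) (key c d a b h1.symm h2.symm)

theorem ConicFrm.Hom.isMonotone {C D : ConicFrm.{u}} (f : ConicFrm.Hom C D) :
    IsMonotone (A := D.toRLoc) (B := C.toRLoc) (ofInvImage f.base.hom) :=
  exists_saturated_lift _ _ fun _ _ h => f.equalises_sim h

/-- The functor `(Ω X, up, down) ↦ (X, inducedRel up down)`, `f⁻¹ ↦ f`. -/
def Rel : ConicFrm.{u}ᵒᵖ ⥤ RocLoc.{u} where
  obj C := ⟨C.unop.toRLoc, hasOpenCones_inducedRel C.unop.parallel⟩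
  map f := ⟨⟨ofInvImage f.unop.base.hom, f.unop.isMonotone⟩⟩
  map_id _ := rfl
  map_comp _ _ := rfl

end LocalicCones

namespace LocalicCones

/-! ### Open cone relations compared with the relations induced by cones. -/

section ConeRelation

variable {L : Type u} [Order.Frame L]

/-! On a relation `R` the rectangle `x ⊗ y` becomes `s⁻¹x ∧ t⁻¹y`. The units of `s_! ⊣ s⁻¹` and `t_!
⊣ t⁻¹` give `t⁻¹y ≤ s⁻¹(↓y)` and `s⁻¹x ≤ t⁻¹(↑x)`, so `R` cannot tell `x ⊗ y` from `(x ∧ ↓y) ⊗ (↑x ∧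
y)`. Since `∼` compares exactly these reduced sides, the quotient map of `R` identifies `∼`-related
rectangles. Hence every element of `R` is saturated, which is the inclusion underlying the unit
(`HasOpenCones.le_inducedRel`).

Conversely, for a parallel pair, `s⁻¹x ≤ t⁻¹z` holds on the induced relation iff `↑x ≤ z`, and
dually for `↓`. As `t_!` is left adjoint to `t⁻¹`, this determines the cones of the induced
relation: they are the given ones (`up_inducedRel`, `down_inducedRel`). So `Cone` after `Rel` is the
identity on the nose (`Rel_comp_Cone`).

Unit and counit are both carried by identities. A morphism in either category is determined by its
underlying map, so naturality and the triangle laws reduce to identities; the only labour is to see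
that transport along equal cones has identity base (`ConicFrm.eqToHom_base`). -/

theorem restrict_rect (R : Sublocale (Coprod L L)) (x y : L) :
    R.restrict (rect x y) = source R x ⊓ target R y := by
  rw [← inl_inf_inr, map_inf]
  rfl

/-- In an open cone relation, a rectangle has the same restriction as the rectangle on its
reduced sides. -/
theorem HasOpenCones.restrict_reduced {R : Sublocale (Coprod L L)} (H : HasOpenCones R) (x y : L) :
    R.restrict (rect x y) = R.restrict (rect (x ⊓ H.down y) (H.up x ⊓ y)) := by
  refine le_antisymm ?_ (OrderHomClass.mono _ (rect_mono inf_le_left inf_le_right))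
  simp only [restrict_rect, map_inf]
  -- The two adjunction units `t⁻¹y ≤ s⁻¹(↓y)` and `s⁻¹x ≤ t⁻¹(↑x)`; Frobenius reciprocity plays no
  -- part here.
  exact le_inf (inf_le_inf_left _ (H.1.gc.le_u_l _)) (inf_le_inf_right _ (H.2.gc.le_u_l _))

theorem HasOpenCones.restrict_eq_of_sim {R : Sublocale (Coprod L L)} (H : HasOpenCones R)
    {a b : Coprod L L} (h : Sim H.up H.down a b) : R.restrict a = R.restrict b := by
  obtain ⟨x, y, x', y', rfl, rfl, h1, h2⟩ := h
  rw [H.restrict_reduced x y, H.restrict_reduced x' y', h1, h2]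

/-- An open cone relation is contained in the relation induced by its cones. -/
theorem HasOpenCones.le_inducedRel {R : Sublocale (Coprod L L)} (H : HasOpenCones R) :
    R ≤ inducedRel H.up H.down := by
  intro w hw a b c hab
  -- An element `w` of `R` sees `d` only through its image in `R`, so anything `R` identifies is
  -- also identified when tested against `w`.
  have key : ∀ d, d ≤ w ↔ R.restrict d ≤ ⟨w, hw⟩ := fun d =>
    (restrict_le_iff R (s := ⟨w, hw⟩)).symm
  rw [key, key, map_inf, map_inf, H.restrict_eq_of_sim hab]

variable {up down : sSupHom L L}

/-- Through the adjunction at the target map, this pins down the up cone of the induced relation.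
One direction tests on the rectangle `x ⊗ ⊤`; the other is parallelism: if `a ∧ ↓b ≤ x`, then `↑a ∧
b ≤ ↑(a ∧ ↓b) ≤ ↑x`. -/
theorem source_le_target_inducedRel_iff (par : Parallel up down) (x z : L) :
    source (inducedRel up down) x ≤ target (inducedRel up down) z ↔ up x ≤ z := by
  rw [source_inducedRel par, target_inducedRel par]
  constructor
  · intro h
    have hx : ((x, ⊤) : L × L) ∈ (downOpen par x).1.1 := (inf_le_left : x ⊓ down ⊤ ≤ x)
    have hz : up x ⊓ ⊤ ≤ z := h hx
    rwa [inf_top_eq] at hz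
  · rintro h ⟨a, b⟩ (hab : a ⊓ down b ≤ x)
    exact ((par a b).1.trans (mono_of_sSupHom up hab)).trans h

/-- The mirror image, with test rectangle `⊤ ⊗ y` and the other half of parallelism. -/
theorem target_le_source_inducedRel_iff (par : Parallel up down) (y z : L) :
    target (inducedRel up down) y ≤ source (inducedRel up down) z ↔ down y ≤ z := by
  rw [source_inducedRel par, target_inducedRel par]
  constructor
  · intro h
    have hy : ((⊤, y) : L × L) ∈ (upOpen par y).1.1 := (inf_le_right : up ⊤ ⊓ y ≤ y)
    have hz : ⊤ ⊓ down y ≤ z := h hy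
    rwa [top_inf_eq] at hz
  · rintro h ⟨a, b⟩ (hab : up a ⊓ b ≤ y)
    exact ((par a b).2.trans (mono_of_sSupHom down hab)).trans h

/-- The up cone of the relation induced by a parallel pair is the given up cone. -/
theorem up_inducedRel (par : Parallel up down) (H : HasOpenCones (inducedRel up down)) :
    H.up = up := by
  ext x
  -- Both values have the same upper bounds `z`, since `t_!(s⁻¹x) ≤ z` iff `s⁻¹x ≤ t⁻¹z`.
  refine eq_of_forall_ge_iff fun z => ?_
  rw [← source_le_target_inducedRel_iff par]
  exact H.2.gc _ _

/-- The down cone of the relation induced by a parallel pair is the given down cone. -/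
theorem down_inducedRel (par : Parallel up down) (H : HasOpenCones (inducedRel up down)) :
    H.down = down := by
  ext y
  refine eq_of_forall_ge_iff fun z => ?_
  rw [← target_le_source_inducedRel_iff par]
  exact H.1.gc _ _

end ConeRelation

/-! ### Strict equality of `Cone` after `Rel` with the identity. -/

theorem ConicFrm.mk_congr {L : Frm.{u}} {up up' down down' : sSupHom L L} (hu : up = up')
    (hd : down = down') (p : Parallel up down) (p' : Parallel up' down') :
    ConicFrm.mk L up down p = ConicFrm.mk L up' down' p' := by
  subst hu hd
  rfl

/-- The frame is fixed and only the cones vary. Keeping the cones as free variables lets their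
equalities be substituted away, after which the transport is literally an identity. -/
theorem ConicFrm.eqToHom_base {L : Frm.{u}} {up up' down down' : sSupHom L L}
    {p : Parallel up down} {p' : Parallel up' down'}
    (h : op (ConicFrm.mk L up down p) = op (ConicFrm.mk L up' down' p')) :
    (eqToHom h).unop.base = 𝟙 L := by
  have e := op_injective h
  injection e with _ hu hd
  subst hu hd
  rfl

theorem Cone_obj_Rel_obj (C : ConicFrm.{u}ᵒᵖ) : Cone.obj (Rel.obj C) = C :=
  congrArg op (ConicFrm.mk_congr (up_inducedRel C.unop.parallel _)
    (down_inducedRel C.unop.parallel _) _ C.unop.parallel)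

theorem eqToHom_Cone_Rel_base {C : ConicFrm.{u}ᵒᵖ} (h : Cone.obj (Rel.obj C) = C) :
    (eqToHom h).unop.base = 𝟙 C.unop.L :=
  ConicFrm.eqToHom_base (p' := C.unop.parallel) h

theorem eqToHom_Cone_Rel_base_symm {C : ConicFrm.{u}ᵒᵖ} (h : C = Cone.obj (Rel.obj C)) :
    (eqToHom h).unop.base = 𝟙 C.unop.L :=
  ConicFrm.eqToHom_base (p := C.unop.parallel) h

/-- The composite of `Rel` and `Cone` is the identity. -/
theorem Rel_comp_Cone : Rel.{u} ⋙ Cone.{u} = 𝟭 ConicFrm.{u}ᵒᵖ := by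
  refine CategoryTheory.Functor.ext Cone_obj_Rel_obj fun C D f => ?_
  refine Quiver.Hom.unop_inj (ConicFrm.Hom.ext ?_)
  -- Passing from the opposite category to frame maps reverses the order of the two transports
  -- around `f`.
  change f.unop.base = ((eqToHom (Cone_obj_Rel_obj D).symm).unop.base ≫ f.unop.base) ≫
    (eqToHom (Cone_obj_Rel_obj C)).unop.base
  rw [eqToHom_Cone_Rel_base, eqToHom_Cone_Rel_base_symm]
  rfl

/-! ### The unit and the adjunction. -/

theorem coprodMap_id (L : Type u) [Order.Frame L] :
    coprodMap (FrameHom.id L) = FrameHom.id (Coprod L L) :=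
  coprod_hom_ext fun x y => coprodMap_rect _ x y

/-- The identity of a locale is monotone from a relation to any relation that contains it. -/
theorem isMonotone_id {X : Locale.{u}} {R Q : Sublocale (Coprod X X)} (h : R ≤ Q) :
    IsMonotone (A := ⟨X, R⟩) (B := ⟨X, Q⟩) (𝟙 X) := by
  obtain ⟨g, hg⟩ : ∃ g : FrameHom Q R, g.comp Q.restrict = R.restrict := by
    -- The closure of `a` in `R` already lies in `Q`, so it bounds the closure of `a` in `Q`;
    -- closing in `Q` first changes nothing.
    have key : ∀ a, R.restrict (Q.restrict a).1 = R.restrict a := fun a =>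
      le_antisymm ((restrict_le_iff R).2
        ((restrict_le_iff Q (s := ⟨_, h (R.restrict a).2⟩)).2 (le_restrict R a)))
        (OrderHomClass.mono _ (le_restrict Q a))
    refine ⟨{ toFun := fun s => R.restrict s.1
              map_inf' := fun a b => map_inf R.restrict a.1 b.1
              map_top' := map_top R.restrict
              map_sSup' := fun S => ?_ }, by ext1 a; exact key a⟩
    -- Joins in `Q` are closures of ambient joins, and `key` absorbs that closure.
    have e : sSup S = Q.restrict (sSup (Subtype.val '' S)) := by
      rw [map_sSup, Set.image_image]
      simp only [restrict_coe, Set.image_id']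
    rw [e, key, map_sSup, Set.image_image]
  refine ⟨g, hg.trans ?_⟩
  change _ = R.restrict.comp (coprodMap (FrameHom.id X))
  rw [coprodMap_id]
  rfl

/-- The monotone map from `(X, R)` to `(X, inducedRel up down)` carried by the identity of `X`,
where `up` and `down` are the cones of `R`. -/
def unitApp (A : RocLoc.{u}) : A ⟶ Rel.obj (Cone.obj A) :=
  ⟨⟨𝟙 A.obj.X, isMonotone_id A.property.le_inducedRel⟩⟩

/-- `Cone` is left adjoint to `Rel`. -/
def coneRelAdjunction : Cone.{u} ⊣ Rel.{u} where
  unit :=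
    { app := unitApp
      -- Both composites are carried by the same locale map, and monotonicity is a mere proposition.
      naturality := fun _ _ _ => rfl }
  counit := eqToHom Rel_comp_Cone
  left_triangle_components A := by
    refine Quiver.Hom.unop_inj (ConicFrm.Hom.ext ?_)
    rw [eqToHom_app]
    -- The factor `𝟙 _` is the inverse image map of the unit.
    change (eqToHom (Cone_obj_Rel_obj (Cone.obj A))).unop.base ≫ 𝟙 _ = 𝟙 _
    rw [eqToHom_Cone_Rel_base]
    rfl
  right_triangle_components C := by
    refine InducedCategory.hom_ext (RLoc.Hom.ext ?_)
    rw [eqToHom_app]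
    exact congrArg Quiver.Hom.op (eqToHom_Cone_Rel_base (Cone_obj_Rel_obj C))

end LocalicCones

/-- `Cone` is left adjoint to `Rel`. The counit is the identity (the composite `Rel ⋙ Cone` is equal
to the identity functor, and all components of the counit are carried by identity frame maps). The
unit at `(X, R)` is the inclusion of `R` into the relation induced by the cones of `R`, carried by the
identity map of `X`. -/
theorem mainTheorem1 :
    ∃ (adj : LocalicCones.Cone.{u} ⊣ LocalicCones.Rel.{u})
      (h : LocalicCones.Rel.{u} ⋙ LocalicCones.Cone.{u} = 𝟭 LocalicCones.ConicFrm.{u}ᵒᵖ),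
      adj.counit = eqToHom h ∧
        (∀ C : LocalicCones.ConicFrm.{u}ᵒᵖ, (adj.counit.app C).unop.base = 𝟙 C.unop.L) ∧
        ∀ A : LocalicCones.RocLoc.{u},
          A.obj.rel ≤ LocalicCones.inducedRel A.property.up A.property.down ∧
            (adj.unit.app A).hom.base = 𝟙 A.obj.X :=
  ⟨LocalicCones.coneRelAdjunction, LocalicCones.Rel_comp_Cone, rfl,
    fun C => by
      change ((eqToHom LocalicCones.Rel_comp_Cone).app C).unop.base = _
      rw [eqToHom_app]
      exact LocalicCones.eqToHom_Cone_Rel_base _,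
    fun A => ⟨A.property.le_inducedRel, rfl⟩⟩
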